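/- **Theorem (Local linear convergence).** *Setting.* Let $J:\mathbb R^n\to\mathbb R\cup\{+\infty\}$ be proper, lower semicontinuous and convex, and let $F:\mathbb R^n\to\mathbb R$ be convex and differentiable with $\beta$-Lipschitz continuous gradient. Let $0<\underline\gamma\le\gamma_k\le\bar\gamma<2/\beta$ for all $k$, let $x_0\in\mathbb R^n$ be arbitrary, and let $$x_{k+1}=\operatorname{prox}_{\gamma_kJ}\bigl(x_k-\gamma_k\nabla F(x_k)\bigr),\qquad \operatorname{prox}_{\gamma J}(w)=\operatorname*{argmin}_{z}\ \tfrac1{2\gamma}\|z-w\|^2+J(z).$$ For $x\in\mathbb R^n$ let $T_x$ be the orthogonal complement of the linear subspace parallel to the affine hull of $\partial J(x)$. The function $J$ is *partly smooth at $x$ relative to a set $M\ni x$* if $\partial J(x)\ne\emptyset$ and: $M$ is a $C^2$-manifold around $x$ and $J|_M$ is $C^2$ around $x$; the tangent space of $M$ at $x$ is $T_x$; and the set-valued map $\partial J$ is continuous at $x$ relative to $M$ (in the Painlevé–Kuratowski sense). Suppose that $x_k\to x^\star$, where $x^\star$ minimizes $F+J$, that $J$ is partly smooth at $x^\star$ relative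 to $M$, that $F$ is $C^2$ near $x^\star$, and that $-\nabla F(x^\star)\in\operatorname{ri}\partial J(x^\star)$. Write $T=T_{x^\star}$ and let $P_T$ be the orthogonal projector onto $T$. Quotients with denominator $0$ in bounds on $\bar\gamma$ are read as $+\infty$. Then: **(1) Finite identification.** There is $K\ge 0$ such that $x_k\in M$ for all $k\ge K$. **(2)** Suppose moreover that $\alpha>0$ satisfies $P_T\nabla^2F(x^\star)P_T\succeq\alpha\,\mathrm{Id}$ on $T$, that is, $\langle h,\nabla^2F(x^\star)h\rangle\ge\alpha\|h\|^2$ for all $h\in T$. **(i) Q-linear convergence.** Suppose $\bar\gamma<\min(2\alpha\beta^{-2},2\beta^{-1})$, and put $q(\gamma)=1-2\alpha\gamma+\beta^2\gamma^2$ and $\tilde\rho^2=\max\{q(\underline\gamma),q(\bar\gamma)\}$. Then $\tilde\rho^2<1$, and $\tilde\rho^2\ge0$ if $T\neq\{0\}$ (if $T=\{0\}$ and this maximum is negative, put $\tilde\rho=0$). For every $\rho$ with $\tilde\rho<\rho<1$ there is $K$ such that for all $k\ge K$ $$x_k\in M\quad\text{and}\quad \|x_{k+1}-x^\star\|\le\rho\,\|x_k-x^\star\|.$$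 **(ii) R-linear convergence.** Suppose that $J$ is partly smooth at $x^\star$ relative to the affine manifold $A=x^\star+T$ (this includes the case that $J$ is partly smooth at $x^\star$ relative to the linear manifold $T\ni x^\star$, in which $A=T$). Let $P_A$ be the orthogonal projector onto $A$. The map $P_T\circ\nabla F\circ P_A$ (which is $P_T\nabla F P_T$ if $A=T$) has a smallest Lipschitz constant, and this constant is at most $\beta$. Let $\nu$ be any Lipschitz constant of this map (in particular, the smallest one), suppose $\bar\gamma<\min(2\alpha\nu^{-2},2\beta^{-1})$, and put $\rho_k^2=1-2\alpha\gamma_k+\nu^2\gamma_k^2$. Then $\rho_k^2<1$, and $\rho_k^2\ge0$ if $T\ne\{0\}$ (put $\rho_k=0$ if $\rho_k^2<0$), for all $k$. Furthermore: * For every $\delta>0$ there is $K$ such that $\|x_{k+1}-x^\star\|\le(\rho_k+\delta)\|x_k-x^\star\|$ for all $k\ge K$. * If $\alpha<\nu$, or if $P_T\nabla^2F(y)P_T\succeq\alpha\,\mathrm{Id}$ on $T$ for all $y\in A$ in a neighbourhood of $x^\star$, then there is $K$ such that $\|x_{k+1}-x^\star\|\le\rho_k\|x_k-x^\star\|$ for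 all $k\ge K$. If in addition $\gamma_k=\alpha/\nu^2$ for all $k$ (which requires $\alpha/\nu^2\le\bar\gamma$), then there is $K$ such that for all $k\ge K$ $$\|x_{k+1}-x^\star\|\le\rho^\star\|x_k-x^\star\|,\qquad \rho^\star=\sqrt{1-\alpha^2/\nu^2}$$ (the root of a negative number being read as $0$, which can happen only if $T=\{0\}$). * This rate is optimal: if $\nu>0$, then $\sqrt{1-2\alpha\gamma+\nu^2\gamma^2}$, as a function of $\gamma\in\mathbb R$, attains its minimum $\rho^\star$ at $\gamma=\alpha/\nu^2$ (with the same convention on roots). -/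

import Mathlib

open Filter Topology
open scoped NNReal

/-- The Euclidean space `ℝⁿ`. -/
abbrev Rn (n : ℕ) : Type := EuclideanSpace ℝ (Fin n)

/-! ### Convex functions with values in the extended reals -/

/-- `J : ℝⁿ → ℝ ∪ {+∞}` is proper, lower semicontinuous and convex. -/
structure ProperLscConvex {n : ℕ} (J : Rn n → EReal) : Prop where
  ne_bot : ∀ x, J x ≠ ⊥
  exists_ne_top : ∃ x, J x ≠ ⊤
  lsc : LowerSemicontinuous J
  convex : ∀ (x y : Rn n) (a b : ℝ), 0 ≤ a → 0 ≤ b → a + b = 1 →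
    J (a • x + b • y) ≤ (a : EReal) * J x + (b : EReal) * J y

/-- The subdifferential of convex analysis (empty at points where a proper `J` is `+∞`). -/
def subdiff {n : ℕ} (J : Rn n → EReal) (x : Rn n) : Set (Rn n) :=
  {v | ∀ y, J x + ((inner ℝ v (y - x) : ℝ) : EReal) ≤ J y}

/-- The tangent model subspace: the orthogonal complement of the linear subspace parallel to the
affine hull of the subdifferential. -/
noncomputable def modelSubspace {n : ℕ} (J : Rn n → EReal) (x : Rn n) : Submodule ℝ (Rn n) :=
  (vectorSpan ℝ (subdiff J x))ᗮ

/-- `p = prox_{γ J}(w)`, that is, `p` minimizes `z ↦ ‖z - w‖² / (2γ) + J z`. -/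
def IsProx {n : ℕ} (γ : ℝ) (J : Rn n → EReal) (w p : Rn n) : Prop :=
  IsMinOn (fun z => ((1 / (2 * γ) * ‖z - w‖ ^ 2 : ℝ) : EReal) + J z) Set.univ p

/-- `x` is a sequence generated by the Forward-Backward scheme
`x_{k+1} = prox_{γ_k J}(x_k - γ_k ∇F(x_k))`, with an arbitrary starting point. -/
def IsForwardBackward {n : ℕ} (F : Rn n → ℝ) (J : Rn n → EReal) (γ : ℕ → ℝ) (x : ℕ → Rn n) : Prop :=
  ∀ k, IsProx (γ k) J (x k - γ k • gradient F (x k)) (x (k + 1))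

/-! ### Manifolds and partial smoothness -/

/-- `M` is a `C²`-manifold around `x` with tangent space `T` at `x`: near `x`, the set `M` is the
zero set of a `C²` map `Φ` to some `ℝᵐ` that is a submersion at `x`, and `T = ker Φ'(x)`. -/
def IsC2ManifoldWithTangentAt {n : ℕ} (M : Set (Rn n)) (x : Rn n) (T : Submodule ℝ (Rn n)) : Prop :=
  x ∈ M ∧ ∃ (m : ℕ) (Φ : Rn n → Rn m), ContDiffAt ℝ 2 Φ x ∧
    Function.Surjective (fderiv ℝ Φ x) ∧
    (∀ᶠ y in 𝓝 x, y ∈ M ↔ Φ y = 0) ∧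
    T = LinearMap.ker (fderiv ℝ Φ x : Rn n →ₗ[ℝ] Rn m)

/-- The restriction of `J` to `M` is `C²` around `x`: near `x`, it agrees on `M` with a finite
function that is `C²` near `x`. -/
def IsC2OnAt {n : ℕ} (J : Rn n → EReal) (M : Set (Rn n)) (x : Rn n) : Prop :=
  ∃ g : Rn n → ℝ, ContDiffAt ℝ 2 g x ∧ ∀ᶠ y in 𝓝[M] x, J y = (g y : EReal)

/-- Continuity (in the sense of Painlevé and Kuratowski) of a set-valued map at `x` relative to
`M`: the outer limit of `S y`, as `y → x` in `M`, is contained in `S x`, and `S x` is contained in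
the inner limit. -/
def SetValuedContinuousAt {n : ℕ} (S : Rn n → Set (Rn n)) (M : Set (Rn n)) (x : Rn n) : Prop :=
  (∀ v, (∀ U ∈ 𝓝 v, ∃ᶠ y in 𝓝[M] x, (S y ∩ U).Nonempty) → v ∈ S x) ∧
  (∀ v ∈ S x, ∀ U ∈ 𝓝 v, ∀ᶠ y in 𝓝[M] x, (S y ∩ U).Nonempty)

/-- `J` is partly smooth at `x` relative to `M`. -/
structure PartlySmoothAt {n : ℕ} (J : Rn n → EReal) (x : Rn n) (M : Set (Rn n)) : Prop where
  proper : ProperLscConvex J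
  subdiff_nonempty : (subdiff J x).Nonempty
  mem : x ∈ M
  /-- smoothness of the manifold -/
  manifold : ∃ T, IsC2ManifoldWithTangentAt M x T
  /-- smoothness of the restriction -/
  smooth : IsC2OnAt J M x
  /-- sharpness -/
  sharp : IsC2ManifoldWithTangentAt M x (modelSubspace J x)
  /-- continuity -/
  continuous : SetValuedContinuousAt (subdiff J) M x

/-- The affine subspace `x + T_x`. -/
noncomputable def modelAffine {n : ℕ} (J : Rn n → EReal) (x : Rn n) : AffineSubspace ℝ (Rn n) :=
  AffineSubspace.mk' x (modelSubspace J x)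

/-- `J` is partly smooth at `x` relative to the affine manifold `x + T_x`. -/
def PartlySmoothAffineAt {n : ℕ} (J : Rn n → EReal) (x : Rn n) : Prop :=
  PartlySmoothAt J x (modelAffine J x : Set (Rn n))

/-- `J` is partly smooth at `x` relative to the linear manifold `T_x`. -/
def PartlySmoothLinearAt {n : ℕ} (J : Rn n → EReal) (x : Rn n) : Prop :=
  PartlySmoothAt J x (modelSubspace J x : Set (Rn n))

/-! ### Second order condition and rates -/

/-- The Hessian of `F` at `x`, as the derivative of the gradient. -/
noncomputable def hessian {n : ℕ} (F : Rn n → ℝ) (x : Rn n) : Rn n →L[ℝ] Rn n :=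
  fderiv ℝ (gradient F) x

/-- `P_T ∇²F(x) P_T ⪰ α Id` on the subspace `T`. -/
def RestrictedStrongConvexAt {n : ℕ} (F : Rn n → ℝ) (T : Submodule ℝ (Rn n)) (α : ℝ) (x : Rn n) :
    Prop :=
  ∀ h ∈ T, α * ‖h‖ ^ 2 ≤ inner ℝ (T.starProjection (hessian F x (T.starProjection h))) h

/-- The map `P_T ∘ ∇F ∘ P_A`, where `P_A y = x + P_T (y - x)` is the orthogonal projector onto the
affine space `A = x + T`. If `A` is the linear space `T` (i.e. `x ∈ T`), this is
`P_T ∘ ∇F ∘ P_T`. -/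
noncomputable def projectedGradient {n : ℕ} (F : Rn n → ℝ) (T : Submodule ℝ (Rn n)) (x : Rn n) :
    Rn n → Rn n :=
  fun y => T.starProjection (gradient F (x + T.starProjection (y - x)))

/-- The quadratic `1 - 2αγ + c²γ²`, where `c` is a Lipschitz constant. -/
def rateSq (α c γ : ℝ) : ℝ := 1 - 2 * α * γ + c ^ 2 * γ ^ 2

/-!
Every step of the scheme produces a subgradient `u` of `J` at the new iterate, close to `-∇F(xs)`
(`IsForwardBackward.mem_subdiff`). Everything else is extracted from monotonicity of `∂J`.

*Identification* (`PartlySmoothAt.eventually_mem`). Displace the iterates that are off `M` along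
the normal space `Tᗮ = vectorSpan ∂J(xs)` onto `M`, and let `a` be a cluster point of the unit
displacements. As `-∇F(xs)` is a relative interior point, `-∇F(xs) + r a` is a subgradient at `xs`
for some `r > 0`, hence, by continuity of `∂J` along `M`, a limit of subgradients at the base points
on `M`. Comparing these with `u`, monotonicity gives `-r ≥ 0`. Of the manifold, only the inverse
function theorem is used; no nearest points and no Riemannian calculus enter.

*Rates* (`IsForwardBackward.eventually_norm_le`). Monotonicity between `x (k + 1)` and `xs` gives
`‖x (k + 1) - xs‖² ≤ ⟪G (x k) - G xs, x (k + 1) - xs⟫` with `G = id - γ ∇F`. Along `M` both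
displacements are tangent up to first order, so that `‖x (k + 1) - xs‖` is at most
`‖P_T (x k - xs) - γ S (x k - xs)‖` with `S = P_T ∇²F(xs) P_T`, up to an error `o(‖x k - xs‖)`.
The bounds `⟪S h, h⟫ ≥ α ‖h‖²` and `‖S h‖ ≤ c ‖h‖` for `h ∈ T` yield the factor `√(1 - 2αγ + c²γ²)`
(`norm_sub_smul_le`).

*The rate without error.* If `α < ν`, the two bounds on `S` cannot be attained simultaneously,
because `S` is symmetric and positive and therefore cocoercive, `‖S h‖² ≤ ν ⟪S h, h⟫`; this leaves a
uniform gap which absorbs the error (`exists_gap_norm_sub_smul`). If strong convexity holds along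
`xs + T` near `xs`, no linearization is needed: on the affine manifold the displacements are exactly
tangent, and the mean value theorem gives the lower bound for `∇F` itself
(`eventually_le_inner_gradient_sub`).
-/

/-! ### Subgradients and proximal points -/

lemma ProperLscConvex.ne_top_of_mem_subdiff {n : ℕ} {J : Rn n → EReal} (hJ : ProperLscConvex J)
    {x v : Rn n} (hv : v ∈ subdiff J x) : J x ≠ ⊤ := by
  obtain ⟨z, hz⟩ := hJ.exists_ne_top
  intro h
  have := hv z
  rw [h, EReal.top_add_coe] at this
  exact hz (top_le_iff.1 this)

lemma ProperLscConvex.subdiff_monotone {n : ℕ} {J : Rn n → EReal} (hJ : ProperLscConvex J)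
    {x y v w : Rn n} (hv : v ∈ subdiff J x) (hw : w ∈ subdiff J y) :
    0 ≤ inner ℝ (v - w) (x - y) := by
  have h1 := hv y
  have h2 := hw x
  rw [← EReal.coe_toReal (hJ.ne_top_of_mem_subdiff hv) (hJ.ne_bot x),
    ← EReal.coe_toReal (hJ.ne_top_of_mem_subdiff hw) (hJ.ne_bot y)] at h1 h2
  norm_cast at h1 h2
  have h3 : inner ℝ v (y - x) = - inner ℝ v (x - y) := by rw [← inner_neg_right, neg_sub]
  rw [inner_sub_left]
  linarith

/-- Fermat's rule for the proximal point: `(w - p) / γ` is a subgradient of `J` at `p`. -/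
lemma IsProx.mem_subdiff {n : ℕ} {J : Rn n → EReal} (hJ : ProperLscConvex J) {γ : ℝ} (hγ : 0 < γ)
    {w p : Rn n} (hp : IsProx γ J w p) : γ⁻¹ • (w - p) ∈ subdiff J p := by
  have hmin : ∀ z, ((1 / (2 * γ) * ‖p - w‖ ^ 2 : ℝ) : EReal) + J p ≤
      ((1 / (2 * γ) * ‖z - w‖ ^ 2 : ℝ) : EReal) + J z := fun z => hp (Set.mem_univ z)
  have hpt : J p ≠ ⊤ := by
    obtain ⟨z, hz⟩ := hJ.exists_ne_top
    intro h
    have h1 := hmin z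
    rw [h, EReal.coe_add_top, ← EReal.coe_toReal hz (hJ.ne_bot z), top_le_iff] at h1
    exact EReal.coe_ne_top _ h1
  intro y
  by_cases hy : J y = ⊤
  · rw [hy]; exact le_top
  obtain ⟨a, ha⟩ : ∃ a : ℝ, J p = a := ⟨_, (EReal.coe_toReal hpt (hJ.ne_bot p)).symm⟩
  obtain ⟨b, hb⟩ : ∃ b : ℝ, J y = b := ⟨_, (EReal.coe_toReal hy (hJ.ne_bot y)).symm⟩
  rw [ha, hb]
  norm_cast
  -- Minimality along the segment from `p` to `y`, divided by the length parameter `t`.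
  have key : ∀ t ∈ Set.Ioo (0 : ℝ) 1,
      a - b + inner ℝ (γ⁻¹ • (w - p)) (y - p) ≤ 1 / (2 * γ) * ‖y - p‖ ^ 2 * t := by
    rintro t ⟨ht0, ht1⟩
    have h1 := hmin ((1 - t) • p + t • y)
    have h2 := hJ.convex p y (1 - t) t (by linarith) ht0.le (by ring)
    rw [ha, hb] at h2
    have h3 := h1.trans (add_le_add le_rfl h2)
    rw [ha] at h3
    norm_cast at h3
    have h4 : (1 - t) • p + t • y - w = t • (y - p) - (w - p) := by module
    rw [h4, norm_sub_sq_real (t • (y - p)), norm_sub_rev p w, norm_smul, Real.norm_of_nonneg ht0.le,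
      real_inner_smul_left] at h3
    rw [real_inner_smul_left, real_inner_comm]
    have h5 : t * (a - b + γ⁻¹ * inner ℝ (y - p) (w - p)) ≤
        t * (1 / (2 * γ) * ‖y - p‖ ^ 2 * t) := by
      have h6 : 1 / (2 * γ) * ((t * ‖y - p‖) ^ 2 - 2 * (t * inner ℝ (y - p) (w - p)) +
          ‖w - p‖ ^ 2) = 1 / (2 * γ) * ‖w - p‖ ^ 2 + t * (1 / (2 * γ) * ‖y - p‖ ^ 2 * t)
            - t * (γ⁻¹ * inner ℝ (y - p) (w - p)) := by
        field_simp
        ring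
      rw [h6] at h3
      nlinarith
    exact le_of_mul_le_mul_left h5 ht0
  have hlim : Tendsto (fun t : ℝ => 1 / (2 * γ) * ‖y - p‖ ^ 2 * t) (𝓝[>] 0) (𝓝 0) := by
    have : Continuous (fun t : ℝ => 1 / (2 * γ) * ‖y - p‖ ^ 2 * t) := by fun_prop
    simpa using (this.tendsto 0).mono_left nhdsWithin_le_nhds
  have := ge_of_tendsto hlim
    (by filter_upwards [Ioo_mem_nhdsGT (zero_lt_one' ℝ)] with t ht using key t ht)
  linarith

/-- The subgradient of `J` at the new iterate that a Forward-Backward step produces. -/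
lemma IsForwardBackward.mem_subdiff {n : ℕ} {F : Rn n → ℝ} {J : Rn n → EReal}
    (hJ : ProperLscConvex J) {γ : ℕ → ℝ} {x : ℕ → Rn n} (hx : IsForwardBackward F J γ x)
    {k : ℕ} (hγ : 0 < γ k) :
    (γ k)⁻¹ • (x k - x (k + 1)) - gradient F (x k) ∈ subdiff J (x (k + 1)) := by
  have := (hx k).mem_subdiff hJ hγ
  convert this using 1
  rw [sub_right_comm, smul_sub (γ k)⁻¹ (x k - x (k + 1)), smul_smul,
    inv_mul_cancel₀ hγ.ne', one_smul]

/-- A relative interior point stays in the set under small moves along the direction of its affine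
hull. -/
lemma exists_ball_of_mem_intrinsicInterior {n : ℕ} {S : Set (Rn n)} {u : Rn n}
    (hu : u ∈ intrinsicInterior ℝ S) :
    ∃ r > 0, ∀ d ∈ vectorSpan ℝ S, ‖d‖ ≤ r → u + d ∈ S := by
  obtain ⟨⟨y, hyS⟩, hy, rfl⟩ := mem_intrinsicInterior.1 hu
  rw [mem_interior_iff_mem_nhds, Metric.mem_nhds_iff] at hy
  obtain ⟨r, hr, hball⟩ := hy
  refine ⟨r / 2, by positivity, fun d hd hdr => ?_⟩
  have hmem : y + d ∈ affineSpan ℝ S := by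
    rw [add_comm]
    exact AffineSubspace.vadd_mem_of_mem_direction (by rwa [direction_affineSpan]) hyS
  have : (⟨y + d, hmem⟩ : affineSpan ℝ S) ∈ Metric.ball ⟨y, hyS⟩ r := by
    rw [Metric.mem_ball, Subtype.dist_eq, dist_eq_norm]
    simp only [add_sub_cancel_left]
    linarith
  exact hball this

/-! ### Manifolds as zero sets -/

/-- Projecting onto a manifold along the normal space at `x`, by the inverse function theorem for
`y ↦ (Φ y, P_T y)`. -/
lemma IsC2ManifoldWithTangentAt.exists_normal_retraction {n : ℕ} {M : Set (Rn n)} {x : Rn n}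
    {T : Submodule ℝ (Rn n)} (hM : IsC2ManifoldWithTangentAt M x T) :
    ∃ p : Rn n → Rn n, Tendsto p (𝓝 x) (𝓝[M] x) ∧ ∀ᶠ y in 𝓝 x, y - p y ∈ Tᗮ := by
  obtain ⟨hxM, m, Φ, hΦ, hsurj, hmem, hT⟩ := hM
  have hker : ∀ d, fderiv ℝ Φ x d = 0 ↔ d ∈ T := fun d => by rw [hT]; simp
  set L : Rn n →L[ℝ] Rn m × T := (fderiv ℝ Φ x).prod T.orthogonalProjectionOnto with hL
  have hinj : LinearMap.ker (L : Rn n →ₗ[ℝ] Rn m × T) = ⊥ := by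
    rw [LinearMap.ker_eq_bot']
    intro d hd
    have hd1 : fderiv ℝ Φ x d = 0 := congrArg Prod.fst hd
    have hd2 : T.orthogonalProjectionOnto d = 0 := congrArg Prod.snd hd
    rw [Submodule.orthogonalProjectionOnto_eq_zero_iff] at hd2
    exact Submodule.disjoint_def.1 T.orthogonal_disjoint d ((hker d).1 hd1) hd2
  have hsur : LinearMap.range (L : Rn n →ₗ[ℝ] Rn m × T) = ⊤ := by
    rw [LinearMap.range_eq_top]
    rintro ⟨a, t⟩
    obtain ⟨d, rfl⟩ := hsurj a
    refine ⟨d - (T.orthogonalProjectionOnto d : Rn n) + t, Prod.ext ?_ ?_⟩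
    · have h1 := (hker _).2 (T.orthogonalProjectionOnto d).2
      have h2 := (hker _).2 t.2
      change fderiv ℝ Φ x _ = fderiv ℝ Φ x d
      rw [map_add, map_sub, h1, h2, sub_zero, add_zero]
    · change T.orthogonalProjectionOnto _ = t
      rw [map_add, map_sub, Submodule.orthogonalProjectionOnto_mem_subspace_eq_self,
        Submodule.orthogonalProjectionOnto_mem_subspace_eq_self, sub_self, zero_add]
  have hstrict : HasStrictFDerivAt (fun y => (Φ y, T.orthogonalProjectionOnto y))
      ((ContinuousLinearEquiv.ofBijective L hinj hsur : Rn n ≃L[ℝ] Rn m × T) :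
        Rn n →L[ℝ] Rn m × T) x := by
    rw [ContinuousLinearEquiv.coe_ofBijective]
    exact (hΦ.hasStrictFDerivAt (by norm_num)).prodMk T.orthogonalProjectionOnto.hasStrictFDerivAt
  have hΦx : Φ x = 0 := hmem.self_of_nhds.1 hxM
  have hproj : Tendsto (fun y => ((0 : Rn m), T.orthogonalProjectionOnto y)) (𝓝 x)
      (𝓝 (Φ x, T.orthogonalProjectionOnto x)) := by
    rw [hΦx]
    exact Continuous.tendsto (by fun_prop) x
  have hp := hstrict.localInverse_tendsto.comp hproj
  have hright := hproj.eventually hstrict.eventually_right_inverse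
  refine ⟨_, tendsto_nhdsWithin_iff.2 ⟨hp, ?_⟩, ?_⟩
  · filter_upwards [hright, hp.eventually hmem] with y hy hy'
    exact hy'.2 (congrArg Prod.fst hy)
  · filter_upwards [hright] with y hy
    rw [← Submodule.orthogonalProjectionOnto_eq_zero_iff, map_sub, sub_eq_zero]
    exact (congrArg Prod.snd hy).symm

/-- Along a manifold, displacements from `x` are tangent up to first order. -/
lemma IsC2ManifoldWithTangentAt.sub_starProjection_isLittleO {n : ℕ} {M : Set (Rn n)} {x : Rn n}
    {T : Submodule ℝ (Rn n)} (hM : IsC2ManifoldWithTangentAt M x T) :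
    (fun y => (y - x) - T.starProjection (y - x)) =o[𝓝[M] x] fun y => y - x := by
  obtain ⟨hxM, m, Φ, hΦ, -, hmem, hT⟩ := hM
  have hker : ∀ d, fderiv ℝ Φ x d = 0 ↔ d ∈ T := fun d => by rw [hT]; simp
  have hΦx : Φ x = 0 := hmem.self_of_nhds.1 hxM
  have hinj : LinearMap.ker ((fderiv ℝ Φ x : Rn n →ₗ[ℝ] Rn m) ∘ₗ Tᗮ.subtype) = ⊥ := by
    rw [LinearMap.ker_eq_bot']
    rintro ⟨d, hd⟩ h
    have h' : d ∈ T := (hker d).1 h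
    exact Subtype.ext (Submodule.disjoint_def.1 T.orthogonal_disjoint d h' hd)
  obtain ⟨C, -, hC⟩ := LinearMap.exists_antilipschitzWith _ hinj
  have hd := (hΦ.differentiableAt (by norm_num)).hasFDerivAt.isLittleO.mono
    (nhdsWithin_le_nhds (s := M))
  refine Asymptotics.IsBigO.trans_isLittleO ?_ hd
  refine Asymptotics.IsBigO.of_bound (C : ℝ) ?_
  filter_upwards [nhdsWithin_le_nhds hmem, self_mem_nhdsWithin] with y hy hyM
  have h1 := hC.le_mul_dist ⟨_, T.sub_starProjection_mem_orthogonal (y - x)⟩ 0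
  have h2 := (hker _).2 (T.starProjection_apply_mem (y - x))
  rw [hy.1 hyM, hΦx, sub_self, zero_sub, norm_neg]
  simpa only [Subtype.dist_eq, dist_eq_norm, map_zero, ZeroMemClass.coe_zero, sub_zero,
    LinearMap.coe_comp, Function.comp_apply, Submodule.coe_subtype, ContinuousLinearMap.coe_coe,
    map_sub (fderiv ℝ Φ x) (y - x), h2, Submodule.coe_norm] using h1

/-! ### Finite identification -/

/-- If subgradients `u k` of `J` at `x k → xs` converge to a relative interior point of
`∂J(xs)`, then `x k` ends up in `M`. Otherwise, the unit normal displacements of `x k` from `M` have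
a cluster point `a`, normal to `T`; since `u + r a` is a subgradient at `xs` that is approximated
by subgradients at nearby points of `M`, monotonicity of `∂J` fails along `a`. -/
lemma PartlySmoothAt.eventually_mem {n : ℕ} {J : Rn n → EReal} {M : Set (Rn n)} {xs : Rn n}
    (hPS : PartlySmoothAt J xs M) {x u : ℕ → Rn n} {us : Rn n}
    (hx : Tendsto x atTop (𝓝 xs)) (hu : Tendsto u atTop (𝓝 us))
    (hus : us ∈ intrinsicInterior ℝ (subdiff J xs))
    (hmem : ∀ᶠ k in atTop, u k ∈ subdiff J (x k)) : ∀ᶠ k in atTop, x k ∈ M := by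
  obtain ⟨p, hp, hnormal⟩ := hPS.sharp.exists_normal_retraction
  obtain ⟨r, hr, hball⟩ := exists_ball_of_mem_intrinsicInterior hus
  have hpx := hp.comp hx
  by_contra hcon
  rw [not_eventually] at hcon
  set d : ℕ → Rn n := fun k => x k - p (x k) with hd
  set e : ℕ → Rn n := fun k => ‖d k‖⁻¹ • d k with he
  have hT : (modelSubspace J xs)ᗮ = vectorSpan ℝ (subdiff J xs) :=
    Submodule.orthogonal_orthogonal _
  have hsphere : ∃ᶠ k in atTop,
      e k ∈ Metric.sphere (0 : Rn n) 1 ∩ (vectorSpan ℝ (subdiff J xs) : Set (Rn n)) := by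
    have hM := (tendsto_nhdsWithin_iff.1 hpx).2
    refine (hcon.and_eventually (hM.and (hx.eventually hnormal))).mono ?_
    rintro k ⟨hk, hkM, hkn⟩
    have hd0 : d k ≠ 0 := fun h => hk (by
      have : x k = p (x k) := sub_eq_zero.1 h
      rw [this]; exact hkM)
    refine ⟨?_, ?_⟩
    · rw [mem_sphere_zero_iff_norm, he, norm_smul, norm_inv, norm_norm,
        inv_mul_cancel₀ (norm_ne_zero_iff.2 hd0)]
    · rw [hT] at hkn
      exact Submodule.smul_mem _ _ hkn
  have hcpt : IsCompact
      (Metric.sphere (0 : Rn n) 1 ∩ (vectorSpan ℝ (subdiff J xs) : Set (Rn n))) :=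
    (isCompact_sphere _ _).inter_right (Submodule.closed_of_finiteDimensional _)
  obtain ⟨a, ⟨ha1, haV⟩, hcl⟩ := hcpt.exists_mapClusterPt_of_frequently hsphere
  rw [mem_sphere_zero_iff_norm] at ha1
  have hv := hball (r • a) (Submodule.smul_mem _ _ haV)
    (by rw [norm_smul, ha1, mul_one, Real.norm_of_nonneg hr.le])
  -- The margin is chosen so that `r ε + 2 ε < r`.
  set ε : ℝ := r / (2 * (r + 2)) with hε
  have hε0 : 0 < ε := by positivity
  have h1 := hpx.eventually (hPS.continuous.2 _ hv _ (Metric.ball_mem_nhds _ hε0))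
  have h2 := hu.eventually (Metric.ball_mem_nhds us hε0)
  have h3 := hcl.frequently (Metric.ball_mem_nhds a hε0)
  obtain ⟨k, hk3, ⟨v, hvJ, hvb⟩, hk2, hk⟩ := (h3.and_eventually (h1.and (h2.and hmem))).exists
  rw [dist_eq_norm] at hk3 hk2
  rw [Metric.mem_ball, dist_eq_norm] at hvb
  have hmono := hPS.proper.subdiff_monotone hk hvJ
  have hmono' : 0 ≤ inner ℝ (u k - v) (e k) := by
    rw [he, real_inner_smul_right]
    exact mul_nonneg (by positivity) hmono
  have hek : ‖e k‖ ≤ 1 := by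
    rw [he, norm_smul, norm_inv, norm_norm]
    exact inv_mul_le_one
  have hsplit : inner ℝ (u k - v) (e k) = inner ℝ (u k - us) (e k)
      - inner ℝ (v - (us + r • a)) (e k) - r * inner ℝ a (e k - a) - r := by
    have : inner ℝ a a = (1 : ℝ) := by rw [real_inner_self_eq_norm_sq, ha1]; norm_num
    rw [inner_sub_right a, this, ← sub_eq_zero]
    simp only [inner_sub_left, inner_add_left, real_inner_smul_left]
    ring
  have i1 : inner ℝ (u k - us) (e k) ≤ ε := (real_inner_le_norm _ _).trans (by
    nlinarith [norm_nonneg (u k - us), norm_nonneg (e k)])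
  have i2 : |inner ℝ (v - (us + r • a)) (e k)| ≤ ε := (abs_real_inner_le_norm _ _).trans (by
    nlinarith [norm_nonneg (v - (us + r • a)), norm_nonneg (e k)])
  have i3 : |inner ℝ a (e k - a)| ≤ ε := (abs_real_inner_le_norm _ _).trans (by
    rw [ha1, one_mul]; exact hk3.le)
  have i4 : r * ε + 2 * ε = r / 2 := by rw [hε]; field_simp
  have i5 := mul_le_mul_of_nonneg_left (neg_le_of_abs_le i3) hr.le
  linarith [neg_le_of_abs_le i2]

/-- Finite identification for the Forward-Backward scheme. -/
lemma IsForwardBackward.eventually_mem {n : ℕ} {F : Rn n → ℝ} {J : Rn n → EReal} {β : ℝ≥0}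
    (hFlip : LipschitzWith β (gradient F)) {γ : ℕ → ℝ} {γlo : ℝ} (hγlo : 0 < γlo)
    (hγ : ∀ k, γlo ≤ γ k) {x : ℕ → Rn n} (hx : IsForwardBackward F J γ x)
    {xs : Rn n} (hlim : Tendsto x atTop (𝓝 xs)) {M : Set (Rn n)} (hPS : PartlySmoothAt J xs M)
    (hnd : -gradient F xs ∈ intrinsicInterior ℝ (subdiff J xs)) :
    ∀ᶠ k in atTop, x k ∈ M := by
  have hlim1 := (tendsto_add_atTop_iff_nat 1).2 hlim
  have hdiff : Tendsto (fun k => (γ k)⁻¹ • (x k - x (k + 1))) atTop (𝓝 0) := by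
    have h0 : Tendsto (fun k => γlo⁻¹ * ‖x k - x (k + 1)‖) atTop (𝓝 0) := by
      simpa using ((hlim.sub hlim1).norm).const_mul γlo⁻¹
    refine squeeze_zero_norm (fun k => ?_) h0
    rw [norm_smul, norm_inv, Real.norm_of_nonneg (hγlo.le.trans (hγ k))]
    gcongr
    exact hγ k
  have hu : Tendsto (fun k => (γ k)⁻¹ • (x k - x (k + 1)) - gradient F (x k)) atTop
      (𝓝 (-gradient F xs)) := by
    simpa using hdiff.sub ((hFlip.continuous.tendsto xs).comp hlim)
  have := hPS.eventually_mem hlim1 hu hnd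
    (Eventually.of_forall fun k => hx.mem_subdiff hPS.proper (hγlo.trans_le (hγ k)))
  rw [eventually_atTop] at this ⊢
  obtain ⟨K, hK⟩ := this
  refine ⟨K + 1, fun k hk => ?_⟩
  obtain ⟨j, rfl⟩ : ∃ j, k = j + 1 := ⟨k - 1, by omega⟩
  exact hK j (by omega)

/-! ### The Hessian -/

lemma contDiffAt_gradient {n : ℕ} {F : Rn n → ℝ} {x : Rn n} (hF : ContDiffAt ℝ 2 F x) :
    ContDiffAt ℝ 1 (gradient F) x :=
  (InnerProductSpace.toDual ℝ (Rn n)).symm.contDiff.contDiffAt.comp x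
    (hF.fderiv_right (m := 1) (by norm_num))

lemma hasFDerivAt_gradient {n : ℕ} {F : Rn n → ℝ} {x : Rn n}
    (hF : ContDiffAt ℝ 2 F x) : HasFDerivAt (gradient F) (hessian F x) x :=
  ((contDiffAt_gradient hF).differentiableAt (by norm_num)).hasFDerivAt

lemma hessian_symmetric {n : ℕ} {F : Rn n → ℝ} {x : Rn n} (hF : ContDiffAt ℝ 2 F x)
    (v w : Rn n) : inner ℝ (hessian F x v) w = inner ℝ v (hessian F x w) := by
  have key : ∀ v w, inner ℝ (hessian F x v) w = fderiv ℝ (fderiv ℝ F) x v w := by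
    intro v w
    have h1 := (hasFDerivAt_gradient hF).inner ℝ (hasFDerivAt_const w x)
    have h2 := (((hF.fderiv_right (m := 1) (by norm_num)).differentiableAt
      (by norm_num)).hasFDerivAt).clm_apply (hasFDerivAt_const w x)
    have h3 : (fun y => inner ℝ (gradient F y) w) = fun y => fderiv ℝ F y w :=
      funext fun y => InnerProductSpace.toDual_symm_apply
    rw [h3] at h1
    simpa using congrArg (fun L => L v) (h1.unique h2)
  rw [key, real_inner_comm, key]
  exact hF.isSymmSndFDerivAt (by simp) v w

/-- `P_T ∇²F(x) P_T` inherits every Lipschitz constant of the projected gradient. -/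
lemma norm_projected_hessian_le {n : ℕ} {F : Rn n → ℝ} {x : Rn n} (hF : ContDiffAt ℝ 2 F x)
    {T : Submodule ℝ (Rn n)} {ν : ℝ≥0} (hν : LipschitzWith ν (projectedGradient F T x)) (h : Rn n) :
    ‖T.starProjection (hessian F x (T.starProjection h))‖ ≤ ν * ‖T.starProjection h‖ := by
  have h1 : HasFDerivAt (fun y => x + T.starProjection (y - x)) T.starProjection x := by
    simpa only [map_sub] using
      ((T.starProjection.hasFDerivAt (x := x)).sub_const (T.starProjection x)).const_add x
  have h2 : HasFDerivAt (gradient F) (hessian F x) (x + T.starProjection (x - x)) := by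
    simpa using (hasFDerivAt_gradient hF)
  have h3 : HasFDerivAt (projectedGradient F T x)
      (T.starProjection.comp ((hessian F x).comp T.starProjection)) x :=
    HasFDerivAt.comp x (T.starProjection.hasFDerivAt)
      (HasFDerivAt.comp (f := fun y => x + T.starProjection (y - x)) x h2 h1)
  have h4 := ContinuousLinearMap.le_of_opNorm_le _ (h3.le_of_lipschitz hν) (T.starProjection h)
  have h5 : T.starProjection (T.starProjection h) = T.starProjection h :=
    Submodule.starProjection_eq_self_iff.2 (T.starProjection_apply_mem h)
  simpa [h5] using h4

lemma lipschitzWith_projectedGradient {n : ℕ} {F : Rn n → ℝ} {β : ℝ≥0}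
    (hF : LipschitzWith β (gradient F)) (T : Submodule ℝ (Rn n)) (x : Rn n) :
    LipschitzWith β (projectedGradient F T x) := by
  have h := T.lipschitzWith_starProjection
  have h1 : LipschitzWith 1 (fun y => x + T.starProjection (y - x)) := by
    refine LipschitzWith.of_dist_le_mul fun y z => ?_
    rw [dist_add_left]
    refine (h.dist_le_mul _ _).trans ?_
    rw [dist_sub_right]
  have h2 := h.comp (hF.comp h1)
  rwa [one_mul, mul_one] at h2

/-- The infimum of the Lipschitz constants is a Lipschitz constant. -/
lemma LipschitzWith.isLeast_sInf {X Y : Type*} [PseudoMetricSpace X] [PseudoMetricSpace Y]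
    {f : X → Y} {C : ℝ≥0} (hf : LipschitzWith C f) :
    IsLeast {c : ℝ≥0 | LipschitzWith c f} (sInf {c : ℝ≥0 | LipschitzWith c f}) := by
  have hcl : IsClosed {c : ℝ≥0 | LipschitzWith c f} := by
    simp only [lipschitzWith_iff_dist_le_mul, Set.ofPred_forall]
    exact isClosed_iInter fun x => isClosed_iInter fun y =>
      isClosed_le continuous_const (by fun_prop)
  exact hcl.isLeast_csInf ⟨C, hf⟩ (OrderBot.bddBelow _)

/-! ### The rate quadratic and contraction estimates -/

lemma rateSq_lt_one {α c γ γhi : ℝ} (hγ : 0 < γ) (hle : γ ≤ γhi) (h : γhi * c ^ 2 < 2 * α) :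
    rateSq α c γ < 1 := by
  have : γ * c ^ 2 ≤ γhi * c ^ 2 := by gcongr
  unfold rateSq
  nlinarith

/-- A convex quadratic is bounded on an interval by its values at the endpoints. -/
lemma rateSq_le_max (α c : ℝ) {γ a b : ℝ} (h1 : a ≤ γ) (h2 : γ ≤ b) :
    rateSq α c γ ≤ max (rateSq α c a) (rateSq α c b) := by
  have h : γ ^ 2 ≤ (a + b) * γ - a * b := by nlinarith
  have h' := mul_le_mul_of_nonneg_left h (sq_nonneg c)
  unfold rateSq
  rcases le_total 0 (-2 * α + c ^ 2 * (a + b)) with hm | hm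
  · refine le_max_of_le_right ?_
    nlinarith [mul_nonneg hm (sub_nonneg.2 h2)]
  · refine le_max_of_le_left ?_
    nlinarith [mul_nonneg (neg_nonneg.2 hm) (sub_nonneg.2 h1)]

lemma rateSq_argmin {α ν : ℝ} (hν : ν ≠ 0) : rateSq α ν (α / ν ^ 2) = 1 - α ^ 2 / ν ^ 2 := by
  unfold rateSq
  field_simp
  ring

lemma rateSq_argmin_le {α ν : ℝ} (hν : ν ≠ 0) (t : ℝ) : 1 - α ^ 2 / ν ^ 2 ≤ rateSq α ν t := by
  have h : rateSq α ν t = 1 - α ^ 2 / ν ^ 2 + (ν * t - α / ν) ^ 2 := by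
    unfold rateSq
    field_simp
    ring
  rw [h]
  exact le_add_of_nonneg_right (sq_nonneg _)

section Contraction

variable {E : Type*} [NormedAddCommGroup E] [InnerProductSpace ℝ E]

lemma norm_sub_smul_sq_le {α c γ : ℝ} (hγ : 0 ≤ γ) {h w : E} (h1 : α * ‖h‖ ^ 2 ≤ inner ℝ w h)
    (h2 : ‖w‖ ≤ c * ‖h‖) : ‖h - γ • w‖ ^ 2 ≤ rateSq α c γ * ‖h‖ ^ 2 := by
  rw [norm_sub_sq_real, real_inner_smul_right, real_inner_comm, norm_smul,
    Real.norm_of_nonneg hγ]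
  have h3 : ‖w‖ ^ 2 ≤ (c * ‖h‖) ^ 2 := by gcongr
  have h4 := mul_le_mul_of_nonneg_left h3 (sq_nonneg γ)
  have h5 := mul_le_mul_of_nonneg_left h1 hγ
  unfold rateSq
  linarith

lemma norm_sub_smul_le {α c γ : ℝ} (hγ : 0 ≤ γ) {h w : E} (h1 : α * ‖h‖ ^ 2 ≤ inner ℝ w h)
    (h2 : ‖w‖ ≤ c * ‖h‖) : ‖h - γ • w‖ ≤ √(rateSq α c γ) * ‖h‖ := by
  have := Real.le_sqrt_of_sq_le (norm_sub_smul_sq_le hγ h1 h2)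
  rwa [Real.sqrt_mul' _ (sq_nonneg _), Real.sqrt_sq (norm_nonneg _)] at this

lemma rateSq_nonneg {α c γ : ℝ} (hγ : 0 ≤ γ) {h w : E} (h0 : h ≠ 0)
    (h1 : α * ‖h‖ ^ 2 ≤ inner ℝ w h) (h2 : ‖w‖ ≤ c * ‖h‖) : 0 ≤ rateSq α c γ :=
  nonneg_of_mul_nonneg_left ((sq_nonneg _).trans (norm_sub_smul_sq_le hγ h1 h2))
    (pow_pos (norm_pos_iff.2 h0) 2)

/-- If `α < ν` and `w` is cocoercive with respect to `h`, then the rate `√(1 - 2αγ + ν²γ²)` is not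
attained at `h ≠ 0`: it would need `⟪w, h⟫ = α ‖h‖²` and `‖w‖ = ν ‖h‖` at once. The strict gap is uniform in
the step sizes that are bounded below. -/
lemma exists_gap_norm_sub_smul {α ν γlo : ℝ} (hα : 0 < α) (hαν : α < ν) (hγlo : 0 < γlo) :
    ∃ δ > 0, ∀ γ ≥ γlo, rateSq α ν γ ≤ 1 → ∀ h w : E, α * ‖h‖ ^ 2 ≤ inner ℝ w h →
      ‖w‖ ≤ ν * ‖h‖ → ‖w‖ ^ 2 ≤ ν * inner ℝ w h →
      ‖h - γ • w‖ + δ * ‖h‖ ≤ √(rateSq α ν γ) * ‖h‖ := by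
  have hν : 0 < ν := hα.trans hαν
  have hd : 0 < ν - α := sub_pos.2 hαν
  set c := min (γlo ^ 2 * ν * (ν - α)) (2 * γlo * (ν - α)) with hc
  have hc0 : 0 < c := lt_min (by positivity) (by positivity)
  refine ⟨c / 2, by positivity, fun γ hγ hq1 h w h1 h2 h3 => ?_⟩
  have hγ0 : 0 < γ := hγlo.trans_le hγ
  have hgap1 : c ≤ γ ^ 2 * ν * (ν - α) := (min_le_left _ _).trans (by gcongr)
  have hgap2 : c ≤ 2 * γ * (ν - α) := (min_le_right _ _).trans (by gcongr)
  have h4 : inner ℝ w h ≤ ν * ‖h‖ ^ 2 := (real_inner_le_norm w h).trans (by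
    nlinarith [norm_nonneg h])
  set q := rateSq α ν γ with hq
  have key : ‖h - γ • w‖ ^ 2 ≤ (q - c) * ‖h‖ ^ 2 := by
    rw [norm_sub_sq_real, real_inner_smul_right, real_inner_comm, norm_smul,
      Real.norm_of_nonneg hγ0.le, hq, rateSq]
    set a : ℝ := inner ℝ w h
    have h5 := mul_le_mul_of_nonneg_left h3 (sq_nonneg γ)
    have h6 := mul_le_mul_of_nonneg_right hgap1 (sq_nonneg ‖h‖)
    have h7 := mul_le_mul_of_nonneg_right hgap2 (sq_nonneg ‖h‖)
    -- The upper bound `γ (γ ν - 2) a` is linear in `a ∈ [α ‖h‖², ν ‖h‖²]`.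
    rcases le_total (γ * ν) 2 with hs | hs
    · nlinarith [mul_nonneg (mul_nonneg hγ0.le (sub_nonneg.2 hs)) (sub_nonneg.2 h1)]
    · nlinarith [mul_nonneg (mul_nonneg hγ0.le (sub_nonneg.2 hs)) (sub_nonneg.2 h4)]
  rcases eq_or_ne h 0 with rfl | h0
  · have : w = 0 := by simpa using h2
    simp [this]
  have hqc : 0 ≤ q - c :=
    nonneg_of_mul_nonneg_left ((sq_nonneg _).trans key) (pow_pos (norm_pos_iff.2 h0) 2)
  have hq0 : 0 ≤ q := by linarith
  have hs1 : √q ≤ 1 := Real.sqrt_le_one.2 hq1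
  have hs2 : √q ^ 2 = q := Real.sq_sqrt hq0
  have hs3 : c / 2 ≤ √q := by nlinarith [Real.sqrt_nonneg q]
  have : ‖h - γ • w‖ ^ 2 ≤ ((√q - c / 2) * ‖h‖) ^ 2 := by
    refine key.trans ?_
    rw [mul_pow]
    gcongr
    nlinarith
  have := abs_le_of_sq_le_sq this (mul_nonneg (sub_nonneg.2 hs3) (norm_nonneg h))
  linarith [le_abs_self ‖h - γ • w‖]

end Contraction

/-- `P_T ∇²F(x) P_T` is cocoercive, by the Cauchy-Schwarz inequality for the positive semidefinite
form it defines. -/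
lemma RestrictedStrongConvexAt.norm_sq_le {n : ℕ} {F : Rn n → ℝ} {x : Rn n}
    (hF : ContDiffAt ℝ 2 F x) {T : Submodule ℝ (Rn n)} {α : ℝ} (hα : 0 ≤ α)
    (hR : RestrictedStrongConvexAt F T α x) {ν : ℝ≥0} (hν0 : 0 < ν)
    (hν : LipschitzWith ν (projectedGradient F T x)) {h : Rn n} (hh : h ∈ T) :
    ‖T.starProjection (hessian F x (T.starProjection h))‖ ^ 2 ≤
      ν * inner ℝ (T.starProjection (hessian F x (T.starProjection h))) h := by
  have hS := norm_projected_hessian_le hF hν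
  set S : Rn n →L[ℝ] Rn n := T.starProjection.comp ((hessian F x).comp T.starProjection) with hSdef
  have hsymm : ∀ v w, inner ℝ (S v) w = inner ℝ v (S w) := fun v w => by
    simp only [hSdef, ContinuousLinearMap.comp_apply]
    rw [Submodule.inner_starProjection_left_eq_right, hessian_symmetric hF,
      Submodule.inner_starProjection_left_eq_right]
  have hST : S h ∈ T := T.starProjection_apply_mem _
  change ‖S h‖ ^ 2 ≤ ν * inner ℝ (S h) h
  have hν' : (0 : ℝ) < ν := hν0
  -- Positivity of the form at `h - ν⁻¹ S h` suffices, since `⟪S (S h), S h⟫ ≤ ν ‖S h‖²`.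
  have hpos : 0 ≤ inner ℝ (S (h - (ν : ℝ)⁻¹ • S h)) (h - (ν : ℝ)⁻¹ • S h) :=
    (mul_nonneg hα (sq_nonneg _)).trans (hR _ (T.sub_mem hh (T.smul_mem _ hST)))
  have hb : inner ℝ (S (S h)) (S h) ≤ ν * ‖S h‖ ^ 2 := by
    refine (real_inner_le_norm _ _).trans ?_
    have h1 : ‖S (S h)‖ ≤ ν * ‖S h‖ := (hS (S h)).trans (by
      gcongr; exact T.norm_starProjection_apply_le _)
    nlinarith [norm_nonneg (S h)]
  rw [map_sub, map_smul, inner_sub_left, inner_sub_right, inner_sub_right, real_inner_smul_left,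
    real_inner_smul_left, real_inner_smul_right, real_inner_smul_right, hsymm (S h) h,
    real_inner_self_eq_norm_sq] at hpos
  have h3 : (ν : ℝ)⁻¹ * ((ν : ℝ)⁻¹ * inner ℝ (S (S h)) (S h)) ≤ (ν : ℝ)⁻¹ * ‖S h‖ ^ 2 := by
    gcongr
    rwa [inv_mul_le_iff₀ hν']
  rw [← inv_mul_le_iff₀ hν']
  linarith

/-- Strong convexity along `x + T` near `x` makes the gradient strongly monotone from `x`, by the
mean value theorem on segments. -/
lemma eventually_le_inner_gradient_sub {n : ℕ} {F : Rn n → ℝ} {x : Rn n}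
    (hF : ContDiffAt ℝ 2 F x) {T : Submodule ℝ (Rn n)} {α : ℝ}
    (hR : ∀ᶠ y in 𝓝[(AffineSubspace.mk' x T : Set (Rn n))] x, RestrictedStrongConvexAt F T α y) :
    ∀ᶠ y in 𝓝 x, y - x ∈ T → α * ‖y - x‖ ^ 2 ≤ inner ℝ (gradient F y - gradient F x) (y - x) := by
  rw [eventually_nhdsWithin_iff] at hR
  obtain ⟨r, hr, hball⟩ := Metric.eventually_nhds_iff_ball.1 (hR.and (hF.eventually (by simp)))
  filter_upwards [Metric.ball_mem_nhds x hr] with y hy hyT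
  set h := y - x with hh
  have hseg : ∀ t ∈ Set.Icc (0 : ℝ) 1, x + t • h ∈ Metric.ball x r := by
    rintro t ⟨h0, h1⟩
    rw [Metric.mem_ball, dist_eq_norm] at hy ⊢
    rw [add_sub_cancel_left, norm_smul, Real.norm_of_nonneg h0]
    exact (mul_le_of_le_one_left (norm_nonneg _) h1).trans_lt hy
  have hderiv : ∀ t ∈ Set.Icc (0 : ℝ) 1,
      HasDerivAt (fun t : ℝ => inner ℝ (gradient F (x + t • h)) h)
        (inner ℝ (hessian F (x + t • h) h) h) t := by
    intro t ht
    have h1 : HasDerivAt (fun t : ℝ => x + t • h) h t := by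
      simpa using ((hasDerivAt_id t).smul_const h).const_add x
    have h2 := (hasFDerivAt_gradient (hball _ (hseg t ht)).2).comp_hasDerivAt t h1
    simpa using h2.inner ℝ (hasDerivAt_const t h)
  obtain ⟨t, ht, hslope⟩ := exists_hasDerivAt_eq_slope _ _ zero_lt_one
    (fun t ht => (hderiv t ht).continuousAt.continuousWithinAt)
    (fun t ht => hderiv t (Set.Ioo_subset_Icc_self ht))
  have ht' := Set.Ioo_subset_Icc_self ht
  have hconv := (hball _ (hseg t ht')).1
    (AffineSubspace.mem_mk'.2 (by simpa using T.smul_mem t hyT)) h hyT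
  rw [Submodule.inner_starProjection_left_eq_right, Submodule.starProjection_eq_self_iff.2 hyT,
    hslope] at hconv
  simpa [hh, inner_sub_left] using hconv

/-! ### One step of the scheme -/

/-- Monotonicity of `∂J` between the new iterate and the minimizer. -/
lemma IsForwardBackward.norm_sq_le_inner {n : ℕ} {F : Rn n → ℝ} {J : Rn n → EReal}
    (hJ : ProperLscConvex J) {γ : ℕ → ℝ} {x : ℕ → Rn n} (hx : IsForwardBackward F J γ x)
    {xs : Rn n} (hxs : -gradient F xs ∈ subdiff J xs) {k : ℕ} (hγ : 0 < γ k) :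
    ‖x (k + 1) - xs‖ ^ 2 ≤
      inner ℝ (x k - xs - γ k • (gradient F (x k) - gradient F xs)) (x (k + 1) - xs) := by
  have h := hJ.subdiff_monotone (hx.mem_subdiff hJ hγ) hxs
  have h1 : x k - xs - γ k • (gradient F (x k) - gradient F xs) = (x (k + 1) - xs) +
      γ k • ((γ k)⁻¹ • (x k - x (k + 1)) - gradient F (x k) - -gradient F xs) := by
    have : γ k • (γ k)⁻¹ • (x k - x (k + 1)) = x k - x (k + 1) := by
      rw [smul_smul, mul_inv_cancel₀ hγ.ne', one_smul]
    rw [smul_sub (γ k) (_ - _), smul_sub (γ k) (_ • _), this]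
    module
  rw [h1, inner_add_left, real_inner_self_eq_norm_sq, real_inner_smul_left]
  exact le_add_of_nonneg_right (mul_nonneg hγ.le h)

/-- Up to an error of first order, a step along the manifold is bounded by the linearized gradient
step in the tangent space. -/
lemma IsForwardBackward.eventually_norm_le {n : ℕ} {F : Rn n → ℝ} {J : Rn n → EReal} {β : ℝ≥0}
    (hJ : ProperLscConvex J) (hFlip : LipschitzWith β (gradient F)) {γ : ℕ → ℝ} {γhi : ℝ}
    (hγ0 : ∀ k, 0 < γ k) (hγ : ∀ k, γ k ≤ γhi) {x : ℕ → Rn n} (hx : IsForwardBackward F J γ x)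
    {xs : Rn n} (hlim : Tendsto x atTop (𝓝 xs)) {M : Set (Rn n)} {T : Submodule ℝ (Rn n)}
    (hM : IsC2ManifoldWithTangentAt M xs T) (hmem : ∀ᶠ k in atTop, x k ∈ M)
    (hF : ContDiffAt ℝ 2 F xs) (hxs : -gradient F xs ∈ subdiff J xs) {δ : ℝ} (hδ : 0 < δ) :
    ∀ᶠ k in atTop, ‖x (k + 1) - xs‖ ≤ ‖T.starProjection (x k - xs) -
      γ k • T.starProjection (hessian F xs (T.starProjection (x k - xs)))‖ + δ * ‖x k - xs‖ := by
  have hγhi : 0 < γhi := (hγ0 0).trans_le (hγ 0)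
  set ε := δ / (1 + 2 * γhi * β + γhi) with hε
  have hε0 : 0 < ε := by positivity
  have hεδ : ε * (1 + 2 * γhi * β + γhi) = δ := by rw [hε]; field_simp
  have hxM : Tendsto x atTop (𝓝[M] xs) := tendsto_nhdsWithin_iff.2 ⟨hlim, hmem⟩
  have htan := hxM.eventually (hM.sub_starProjection_isLittleO.def hε0)
  have hgrad := hlim.eventually ((hasFDerivAt_gradient hF).isLittleO.def hε0)
  have hH : ‖hessian F xs‖ ≤ β := (hasFDerivAt_gradient hF).le_of_lipschitz hFlip
  filter_upwards [htan, (tendsto_add_atTop_nat 1).eventually htan, hgrad] with k hb ha hD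
  have hmono := hx.norm_sq_le_inner hJ hxs (hγ0 k)
  have hlip := hFlip.norm_sub_le (x k) xs
  set a := x (k + 1) - xs
  set b := x k - xs
  set D := gradient F (x k) - gradient F xs
  set H := hessian F xs
  set P := T.starProjection
  have hg := hγ k
  have hg0 := (hγ0 k).le
  have hβ : (0 : ℝ) ≤ β := β.coe_nonneg
  -- The normal part of the new displacement is negligible.
  have h1 : ‖a‖ ≤ ‖P (b - γ k • D)‖ + ε * (1 + γhi * β) * ‖b‖ := by
    rcases eq_or_ne a 0 with h0 | h0
    · rw [h0, norm_zero]; positivity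
    have hs : inner ℝ (b - γ k • D) a = inner ℝ (P (b - γ k • D)) a
        + inner ℝ (b - γ k • D) (a - P a) := by
      rw [Submodule.inner_starProjection_left_eq_right, ← inner_add_right, add_sub_cancel]
    have h2 : ‖b - γ k • D‖ ≤ (1 + γhi * β) * ‖b‖ := by
      refine (norm_sub_le _ _).trans ?_
      rw [norm_smul, Real.norm_of_nonneg hg0]
      have : γ k * ‖D‖ ≤ γhi * (β * ‖b‖) := by gcongr
      linarith
    have h3 : inner ℝ (b - γ k • D) (a - P a) ≤ (1 + γhi * β) * ‖b‖ * (ε * ‖a‖) :=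
      (real_inner_le_norm _ _).trans (by gcongr)
    have h4 := real_inner_le_norm (P (b - γ k • D)) a
    have h5 : ‖a‖ * ‖a‖ ≤ (‖P (b - γ k • D)‖ + ε * (1 + γhi * β) * ‖b‖) * ‖a‖ := by
      rw [← sq]; linarith
    exact le_of_mul_le_mul_right h5 (norm_pos_iff.2 h0)
  have h2 : P (b - γ k • D) = (P b - γ k • P (H (P b)))
      - γ k • P (H (b - P b) + (D - H b)) := by
    simp only [map_sub, map_smul, map_add]
    module
  have h3 : ‖γ k • P (H (b - P b) + (D - H b))‖ ≤ γhi * (β * (ε * ‖b‖) + ε * ‖b‖) := by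
    rw [norm_smul, Real.norm_of_nonneg hg0]
    have i1 : ‖H (b - P b)‖ ≤ β * (ε * ‖b‖) := (H.le_of_opNorm_le hH _).trans (by gcongr)
    have i2 := (T.norm_starProjection_apply_le (H (b - P b) + (D - H b))).trans
      (norm_add_le _ _)
    gcongr
    linarith
  rw [h2] at h1
  have h4 := norm_sub_le (P b - γ k • P (H (P b))) (γ k • P (H (b - P b) + (D - H b)))
  rw [← hεδ]
  linarith

/-! ### Local linear convergence -/

/-- Local linear convergence of the Forward-Backward scheme under partial smoothness.
The step-size bounds `γhi < 2 / β`, `γhi < 2 α / β²`, `γhi < 2 α / ν²` are written without division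
(so that `2 / 0 = +∞`). -/
theorem mainTheorem1 {n : ℕ} (F : Rn n → ℝ) (J : Rn n → EReal) (β : ℝ≥0)
    (hJ : ProperLscConvex J)
    (hFconv : ConvexOn ℝ Set.univ F) (hFdiff : Differentiable ℝ F)
    (hFlip : LipschitzWith β (gradient F))
    (γ : ℕ → ℝ) (γlo γhi : ℝ) (hγlo : 0 < γlo)
    (hγ : ∀ k, γlo ≤ γ k ∧ γ k ≤ γhi) (hγhi : γhi * β < 2)
    (x : ℕ → Rn n) (hx : IsForwardBackward F J γ x)
    (xs : Rn n) (hlim : Tendsto x atTop (𝓝 xs))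
    (hmin : IsMinOn (fun z => (F z : EReal) + J z) Set.univ xs)
    (M : Set (Rn n)) (hPS : PartlySmoothAt J xs M)
    (hC2 : ContDiffAt ℝ 2 F xs)
    (hnd : -gradient F xs ∈ intrinsicInterior ℝ (subdiff J xs)) :
    -- finite identification
    (∃ K : ℕ, ∀ k ≥ K, x k ∈ M) ∧
    -- local linear convergence
    (∀ α : ℝ, 0 < α → RestrictedStrongConvexAt F (modelSubspace J xs) α xs →
      -- Q-linear convergence
      (γhi * (β : ℝ) ^ 2 < 2 * α →
        (modelSubspace J xs ≠ ⊥ → 0 ≤ max (rateSq α β γlo) (rateSq α β γhi)) ∧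
        max (rateSq α β γlo) (rateSq α β γhi) < 1 ∧
        ∀ ρ : ℝ, √(max (rateSq α β γlo) (rateSq α β γhi)) < ρ → ρ < 1 →
          ∃ K : ℕ, ∀ k ≥ K, x k ∈ M ∧ ‖x (k + 1) - xs‖ ≤ ρ * ‖x k - xs‖) ∧
      -- R-linear convergence for affine or linear manifolds
      (PartlySmoothAffineAt J xs ∨ PartlySmoothLinearAt J xs →
        -- the best Lipschitz constant exists and is at most `β`
        (∃ ν : ℝ≥0, ν ≤ β ∧
          IsLeast {c : ℝ≥0 | LipschitzWith c (projectedGradient F (modelSubspace J xs) xs)} ν) ∧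
        ∀ ν : ℝ≥0, LipschitzWith ν (projectedGradient F (modelSubspace J xs) xs) →
          γhi * (ν : ℝ) ^ 2 < 2 * α →
          (∀ k, (modelSubspace J xs ≠ ⊥ → 0 ≤ rateSq α ν (γ k)) ∧ rateSq α ν (γ k) < 1) ∧
          -- the rate `ρ_k`, up to an arbitrarily small error
          (∀ δ : ℝ, 0 < δ → ∃ K : ℕ, ∀ k ≥ K,
            ‖x (k + 1) - xs‖ ≤ (√(rateSq α ν (γ k)) + δ) * ‖x k - xs‖) ∧
          -- the rate `ρ_k` itself, and the optimal rate
          ((α < ν ∨ ∀ᶠ y in 𝓝[(modelAffine J xs : Set (Rn n))] xs,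
              RestrictedStrongConvexAt F (modelSubspace J xs) α y) →
            (∃ K : ℕ, ∀ k ≥ K,
              ‖x (k + 1) - xs‖ ≤ √(rateSq α ν (γ k)) * ‖x k - xs‖) ∧
            ((∀ k, γ k = α / (ν : ℝ) ^ 2) → ∃ K : ℕ, ∀ k ≥ K,
              ‖x (k + 1) - xs‖ ≤ √(1 - α ^ 2 / (ν : ℝ) ^ 2) * ‖x k - xs‖)) ∧
          -- optimality of the constant step size `α / ν²`
          (0 < ν →
            √(rateSq α ν (α / (ν : ℝ) ^ 2)) = √(1 - α ^ 2 / (ν : ℝ) ^ 2) ∧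
            ∀ t : ℝ, √(1 - α ^ 2 / (ν : ℝ) ^ 2) ≤ √(rateSq α ν t)))) := by
  have hγ0 : ∀ k, 0 < γ k := fun k => hγlo.trans_le (hγ k).1
  have hγle : ∀ k, γ k ≤ γhi := fun k => (hγ k).2
  have hlohi : γlo ≤ γhi := (hγ 0).1.trans (hγ 0).2
  have hxs : -gradient F xs ∈ subdiff J xs := intrinsicInterior_subset hnd
  have hid : ∀ N, PartlySmoothAt J xs N → ∀ᶠ k in atTop, x k ∈ N := fun N hN =>
    hx.eventually_mem hFlip hγlo (fun k => (hγ k).1) hlim hN hnd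
  have hM := hid M hPS
  refine ⟨eventually_atTop.1 hM, fun α hα hR => ?_⟩
  set T := modelSubspace J xs
  have hR' : ∀ h, α * ‖T.starProjection h‖ ^ 2 ≤
      inner ℝ (T.starProjection (hessian F xs (T.starProjection h))) (T.starProjection h) := by
    intro h
    have h1 := hR _ (T.starProjection_apply_mem h)
    rwa [Submodule.starProjection_eq_self_iff.2 (T.starProjection_apply_mem h)] at h1
  have hnonneg : ∀ c : ℝ≥0, LipschitzWith c (projectedGradient F T xs) → T ≠ ⊥ →
      ∀ t, 0 < t → 0 ≤ rateSq α c t := by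
    intro c hc hne t ht
    obtain ⟨h, hh, h0⟩ := T.exists_mem_ne_zero_of_ne_bot hne
    rw [← Submodule.starProjection_eq_self_iff.2 hh] at h0
    exact rateSq_nonneg ht.le h0 (hR' h) (norm_projected_hessian_le hC2 hc h)
  have hstep : ∀ δ > 0, ∀ᶠ k in atTop, ‖x (k + 1) - xs‖ ≤ ‖T.starProjection (x k - xs) -
      γ k • T.starProjection (hessian F xs (T.starProjection (x k - xs)))‖ + δ * ‖x k - xs‖ :=
    fun δ hδ => hx.eventually_norm_le hJ hFlip hγ0 hγle hlim hPS.sharp hM hC2 hxs hδ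
  have hrate : ∀ c : ℝ≥0, LipschitzWith c (projectedGradient F T xs) → ∀ δ > 0,
      ∀ᶠ k in atTop, ‖x (k + 1) - xs‖ ≤ (√(rateSq α c (γ k)) + δ) * ‖x k - xs‖ := by
    intro c hc δ hδ
    filter_upwards [hstep δ hδ] with k hk
    have h1 := norm_sub_smul_le (hγ0 k).le (hR' (x k - xs))
      (norm_projected_hessian_le hC2 hc (x k - xs))
    have h2 := mul_le_mul_of_nonneg_left (T.norm_starProjection_apply_le (x k - xs))
      (Real.sqrt_nonneg (rateSq α c (γ k)))
    linarith
  have hβ := lipschitzWith_projectedGradient hFlip T xs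
  refine ⟨fun hγβ => ⟨fun hne => le_max_of_le_left (hnonneg β hβ hne γlo hγlo),
    max_lt (rateSq_lt_one hγlo hlohi hγβ) (rateSq_lt_one (hγlo.trans_le hlohi) le_rfl hγβ),
    fun ρ hρ _ => ?_⟩, fun haff => ⟨⟨_, csInf_le (OrderBot.bddBelow _) hβ, hβ.isLeast_sInf⟩,
    fun ν hν hγν => ⟨fun k => ⟨fun hne => hnonneg ν hν hne _ (hγ0 k),
      rateSq_lt_one (hγ0 k) (hγle k) hγν⟩, fun δ hδ => eventually_atTop.1 (hrate ν hν δ hδ),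
      fun hcase => ?_, fun hν0 => ?_⟩⟩⟩
  · refine eventually_atTop.1 ?_
    filter_upwards [hM, hrate β hβ _ (sub_pos.2 hρ)] with k hk hk'
    refine ⟨hk, hk'.trans ?_⟩
    gcongr
    linarith [Real.sqrt_le_sqrt (rateSq_le_max α β (hγ k).1 (hγ k).2)]
  · -- After identification, all displacements are tangent.
    have hxT : ∀ᶠ k in atTop, x k - xs ∈ T := by
      rcases haff with h | h
      · exact (hid _ h).mono fun k hk => AffineSubspace.mem_mk'.1 hk
      · exact (hid _ h).mono fun k hk => T.sub_mem hk h.mem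
    have hexact : ∀ᶠ k in atTop, ‖x (k + 1) - xs‖ ≤ √(rateSq α ν (γ k)) * ‖x k - xs‖ := by
      rcases hcase with hαν | hnear
      · obtain ⟨δ, hδ, hgap⟩ := exists_gap_norm_sub_smul (E := Rn n) hα hαν hγlo
        filter_upwards [hxT, hstep δ hδ] with k hkT hk
        have hP := Submodule.starProjection_eq_self_iff.2 hkT
        have h1 := hgap (γ k) (hγ k).1 (rateSq_lt_one (hγ0 k) (hγle k) hγν).le (x k - xs) _
          (hR _ hkT) (by simpa only [hP] using norm_projected_hessian_le hC2 hν (x k - xs))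
          (hR.norm_sq_le hC2 hα.le (by exact_mod_cast hα.trans hαν) hν hkT)
        rw [hP] at hk h1
        exact hk.trans h1
      · filter_upwards [hxT, (tendsto_add_atTop_nat 1).eventually hxT,
          hlim.eventually (eventually_le_inner_gradient_sub hC2 hnear)] with k hkT hkT' hk
        have hP := Submodule.starProjection_eq_self_iff.2 hkT
        have hP' := Submodule.starProjection_eq_self_iff.2 hkT'
        have hlip := hν.norm_sub_le (x k) xs
        simp only [projectedGradient, hP, sub_self, map_zero, add_zero, add_sub_cancel] at hlip
        rw [← map_sub] at hlip
        set w := T.starProjection (gradient F (x k) - gradient F xs) with hw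
        have hin : inner ℝ w (x k - xs) =
            inner ℝ (gradient F (x k) - gradient F xs) (x k - xs) := by
          rw [hw, Submodule.inner_starProjection_left_eq_right, hP]
        have h1 := norm_sub_smul_le (hγ0 k).le (by rw [hin]; exact hk hkT) hlip
        refine le_trans ?_ h1
        rcases eq_or_ne (x (k + 1) - xs) 0 with h0 | h0
        · rw [h0, norm_zero]; positivity
        have h2 := hx.norm_sq_le_inner hJ hxs (hγ0 k)
        rw [← hP', ← Submodule.inner_starProjection_left_eq_right, hP', map_sub, hP, map_smul, ← hw,
          sq] at h2
        exact le_of_mul_le_mul_right (h2.trans (real_inner_le_norm _ _)) (norm_pos_iff.2 h0)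
    refine ⟨eventually_atTop.1 hexact, fun hconst => eventually_atTop.1 ?_⟩
    -- `ν = 0` would make the constant step size zero.
    have hν0 : (ν : ℝ) ≠ 0 := by
      intro h0
      have := hγ0 0
      rw [hconst 0, h0] at this
      simp at this
    filter_upwards [hexact] with k hk
    rwa [hconst k, rateSq_argmin hν0] at hk
  · have hν0' : (ν : ℝ) ≠ 0 := by exact_mod_cast hν0.ne'
    exact ⟨by rw [rateSq_argmin hν0'], fun t => Real.sqrt_le_sqrt (rateSq_argmin_le hν0' t)⟩
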